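/- Let $X$ be a compact connected Riemann surface (for instance the Riemann surface $X_\sigma$ attached to an arithmetic surface over $\operatorname{Spec} O_K$ and an embedding $\sigma:K\hookrightarrow\mathbb C$). For $x\in X$ let $\mathcal O_x$ be the completion of the local ring of germs of holomorphic functions at $x$, $K_x=\operatorname{Frac}\mathcal O_x\cong\mathbb C((t))$ and $v_x$ the normalised valuation of $K_x$. Let $\mathbf A_X$ be the adele ring of $X$, i.e. the ring of families $(a_x)\in\prod_{x\in X}K_x$ with $a_x\in\mathcal O_x$ for all but finitely many $x$, and let $\mathbf A_X^\times$ be its group of units. For $a\in\mathbf A_X$ and $x$ with $a_x\in\mathcal O_x$, write $a(x)\in\mathbb C$ for the image of $a_x$ in the residue field; $a(x)$ is undefined if $a_x\notin\mathcal O_x$. A Green function on $X$ is a function $g:U\to\mathbb R$ such that $U\subseteq X$ is the complement of a finite set, $g$ is $C^\infty$ on $U$, and for every $x\in X$ there are a real number $\alpha$, a holomorphic chart $z$ centred at $x$ and a $C^\infty$ function $u$ near $x$ with $g=\alpha\log|z|^2+u$ near $x$. This is an equality of partial functions: $g$ is defined at all points near $x$ other than $x$, and it is defined at $x$ if and only if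 $\alpha=0$. The number $\alpha$ is unique, and $\operatorname{ord}^G_x(g):=-\alpha$. Let $\mathbb ZG(X)$ be the set of Green functions $g$ with $\operatorname{ord}^G_x(g)\in\mathbb Z$ for all $x\in X$. For $a,b\in\mathbf A_X^\times$ let $\Theta(a,b)$ be the partial function $$x\mapsto-\log\bigl(b(x)\,a(x)\,\overline{a(x)}\bigr),$$ whose domain consists of those $x\in X$ for which $a(x)$ and $b(x)$ are defined and $b(x)a(x)\overline{a(x)}$ is a positive real number. Put $$G(\mathbf A_X^\times):=\bigl\{(a,b)\in\mathbf A_X^\times\times\mathbf A_X^\times:\ \Theta(a,b)\in\mathbb ZG(X),\ v_x(a_x)=\operatorname{ord}^G_x(\Theta(a,b))\ \text{for all }x\in X\bigr\}.$$ Then the map $$\pi:G(\mathbf A_X^\times)\to\mathbb ZG(X),\qquad (a,b)\mapsto\Theta(a,b),$$ is surjective. -/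

import Mathlib

open Filter Set IsLocalRing
open scoped Manifold ContDiff Topology RestrictedProduct ComplexConjugate ComplexOrder

noncomputable section

namespace RiemannSurface

/-! ### Two algebraic facts on discrete valuation rings -/

theorem isDomain_of_factorization {R : Type*} [CommRing R] {t : R}
    (hpow : ∀ n : ℕ, t ^ n ≠ 0) (H : ∀ x : R, x ≠ 0 → ∃ n : ℕ, Associated (t ^ n) x) :
    IsDomain R := by
  have : Nontrivial R := ⟨⟨t ^ 0, 0, hpow 0⟩⟩
  have : NoZeroDivisors R := by
    refine ⟨fun {x y} hxy => ?_⟩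
    by_contra! h
    obtain ⟨n, u, hu⟩ := H x h.1
    obtain ⟨m, w, hw⟩ := H y h.2
    apply hpow (n + m)
    have h1 : t ^ (n + m) * ((u * w : Rˣ) : R) = 0 := by
      rw [← hxy, ← hu, ← hw]; push_cast; ring
    exact (Units.mul_left_eq_zero _).1 h1
  exact NoZeroDivisors.to_isDomain R

theorem isDVR_of_factorization {R : Type*} [CommRing R] [IsDomain R] {t : R}
    (ht : ¬ IsUnit t) (hpow : ∀ n : ℕ, t ^ n ≠ 0)
    (H : ∀ x : R, x ≠ 0 → ∃ n : ℕ, Associated (t ^ n) x) :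
    IsDiscreteValuationRing R := by
  have ht0 : t ≠ 0 := by simpa using hpow 1
  refine IsDiscreteValuationRing.ofHasUnitMulPowIrreducibleFactorization
    ⟨t, ⟨ht, fun a b hab => ?_⟩, fun {x} hx => H x hx⟩
  have ha0 : a ≠ 0 := by rintro rfl; simp at hab; exact ht0 hab
  have hb0 : b ≠ 0 := by rintro rfl; simp at hab; exact ht0 hab
  obtain ⟨n, u, hu⟩ := H a ha0
  obtain ⟨m, w, hw⟩ := H b hb0
  rcases n with _ | n
  · left; rw [← hu]; simp
  rcases m with _ | m
  · right; rw [← hw]; simp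
  exfalso
  apply ht
  have h1 : t * 1 = t * (t * (t ^ (n + m) * (u * w))) := by
    rw [mul_one]; nth_rewrite 1 [hab]; rw [← hu, ← hw]; ring
  exact IsUnit.of_mul_eq_one _ (mul_left_cancel₀ ht0 h1).symm

theorem adicCompletion_factorization (R : Type*) [CommRing R] [IsDomain R]
    [IsDiscreteValuationRing R] :
    ∃ t : AdicCompletion (maximalIdeal R) R, ¬ IsUnit t ∧ (∀ n : ℕ, t ^ n ≠ 0) ∧
      ∀ x, x ≠ 0 → ∃ n : ℕ, Associated (t ^ n) x := by
  obtain ⟨ϖ, hϖ⟩ := IsDiscreteValuationRing.exists_irreducible R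
  let A := AdicCompletion (maximalIdeal R) R
  have hmax : maximalIdeal A = Ideal.span {algebraMap R A ϖ} := by
    have h1 : (maximalIdeal R).map (algebraMap R A) = Ideal.span {algebraMap R A ϖ} :=
      (congrArg (Ideal.map (algebraMap R A)) hϖ.maximalIdeal_eq).trans
        (by rw [Ideal.map_span, Set.image_singleton])
    rw [← h1]
    exact AdicCompletion.maximalIdeal_eq_map
  have hcomp : IsAdicComplete (maximalIdeal A) A := by infer_instance
  refine ⟨algebraMap R A ϖ, ?_, ?_, ?_⟩
  · have : algebraMap R A ϖ ∈ maximalIdeal A := by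
      rw [hmax]; exact Ideal.mem_span_singleton_self _
    exact (mem_maximalIdeal _).1 this
  · intro n hn
    rw [← map_pow] at hn
    have hinj : Function.Injective (algebraMap R A) :=
      AdicCompletion.of_injective (maximalIdeal R) R
    exact pow_ne_zero n hϖ.ne_zero (hinj (by rw [hn, map_zero]))
  · intro x hx
    have hne : ∃ n : ℕ, x ∉ maximalIdeal A ^ n := by
      by_contra! h
      apply hx
      refine IsHausdorff.haus hcomp.toIsHausdorff x fun n => ?_
      rw [SModEq.zero]; simpa using h n
    classical
    have h1 := Nat.find_spec hne
    rcases hk : Nat.find hne with _ | k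
    · rw [hk] at h1; simp at h1
    · rw [hk] at h1
      have h2 : x ∈ maximalIdeal A ^ k := by
        by_contra h; have := Nat.find_min' hne h; omega
      rw [hmax, Ideal.span_singleton_pow] at h1 h2
      obtain ⟨c, rfl⟩ := Ideal.mem_span_singleton.1 h2
      have hc : IsUnit c := by
        by_contra hc
        have : c ∈ maximalIdeal A := (mem_maximalIdeal _).2 hc
        rw [hmax] at this
        obtain ⟨d, rfl⟩ := Ideal.mem_span_singleton.1 this
        exact h1 (Ideal.mem_span_singleton.2 ⟨d, by ring⟩)
      exact ⟨k, hc.unit, by simp⟩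

theorem isDomain_adicCompletion (R : Type*) [CommRing R] [IsDomain R]
    [IsDiscreteValuationRing R] : IsDomain (AdicCompletion (maximalIdeal R) R) := by
  obtain ⟨t, -, h1, h2⟩ := adicCompletion_factorization R
  exact isDomain_of_factorization h1 h2

theorem isDVR_adicCompletion (R : Type*) [CommRing R] [IsDomain R]
    [IsDiscreteValuationRing R] [IsDomain (AdicCompletion (maximalIdeal R) R)] :
    IsDiscreteValuationRing (AdicCompletion (maximalIdeal R) R) := by
  obtain ⟨t, h0, h1, h2⟩ := adicCompletion_factorization R
  exact isDVR_of_factorization h0 h1 h2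

/-! ### The local rings of a Riemann surface -/

section LocalRing

variable {M : Type*} [TopologicalSpace M] [ChartedSpace ℂ M]

/-- The local ring `𝒪_{M,p}`: germs at `p` of functions that are holomorphic near `p`. -/
def holGerm (p : M) : Subring (Germ (𝓝 p) ℂ) where
  carrier := {φ | ∃ f : M → ℂ, (∀ᶠ q in 𝓝 p, MDifferentiableAt 𝓘(ℂ) 𝓘(ℂ) f q) ∧
    (f : Germ (𝓝 p) ℂ) = φ}
  mul_mem' := by
    rintro _ _ ⟨f, hf, rfl⟩ ⟨g, hg, rfl⟩
    exact ⟨f * g, by filter_upwards [hf, hg] with q h1 h2 using h1.mul h2, rfl⟩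
  one_mem' := ⟨fun _ => 1, Eventually.of_forall fun _ => mdifferentiableAt_const, rfl⟩
  add_mem' := by
    rintro _ _ ⟨f, hf, rfl⟩ ⟨g, hg, rfl⟩
    exact ⟨f + g, by filter_upwards [hf, hg] with q h1 h2 using h1.add h2, rfl⟩
  zero_mem' := ⟨fun _ => 0, Eventually.of_forall fun _ => mdifferentiableAt_const, rfl⟩
  neg_mem' := by
    rintro _ ⟨f, hf, rfl⟩
    exact ⟨-f, by filter_upwards [hf] with q h1 using h1.neg, rfl⟩

/-- Evaluation `f ↦ f(p)` of holomorphic germs at `p`. -/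
def evalGerm (p : M) : holGerm p →+* ℂ := Germ.valueRingHom.comp (holGerm p).subtype

theorem holGerm_isUnit {p : M} (φ : holGerm p) (h : evalGerm p φ ≠ 0) : IsUnit φ := by
  obtain ⟨_, f, hf, rfl⟩ := φ
  have hfp : f p ≠ 0 := h
  have hne : ∀ᶠ q in 𝓝 p, f q ≠ 0 := hf.self_of_nhds.continuousAt.eventually_ne hfp
  have hinv : ∀ᶠ q in 𝓝 p, MDifferentiableAt 𝓘(ℂ) 𝓘(ℂ) (fun y => (f y)⁻¹) q := by
    filter_upwards [hf, hne] with q h1 h2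
    exact (differentiableAt_inv h2).mdifferentiableAt.comp q h1
  refine IsUnit.of_mul_eq_one ⟨_, (fun y => (f y)⁻¹), hinv, rfl⟩ (Subtype.ext ?_)
  refine Germ.coe_eq.2 ?_
  filter_upwards [hne] with q hq
  exact mul_inv_cancel₀ hq

variable [IsManifold 𝓘(ℂ) ω M]

theorem holGerm_factorization (p : M) :
    ∃ t : holGerm p, evalGerm p t = 0 ∧ (∀ n : ℕ, t ^ n ≠ 0) ∧
      ∀ x, x ≠ 0 → ∃ n : ℕ, Associated (t ^ n) x := by
  set e := chartAt ℂ p with he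
  have hatlas : e ∈ IsManifold.maximalAtlas 𝓘(ℂ) ω M := IsManifold.chart_mem_maximalAtlas p
  have hp : p ∈ e.source := mem_chart_source ℂ p
  have hω : (ω : WithTop ℕ∞) ≠ 0 := by simp
  have hde : ∀ q ∈ e.source, MDifferentiableAt 𝓘(ℂ) 𝓘(ℂ) e q := fun q hq =>
    ((contMDiffOn_of_mem_maximalAtlas hatlas).contMDiffAt (e.open_source.mem_nhds hq)).mdifferentiableAt hω
  have hds : ∀ w ∈ e.target, MDifferentiableAt 𝓘(ℂ) 𝓘(ℂ) e.symm w := fun w hw =>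
    ((contMDiffOn_symm_of_mem_maximalAtlas hatlas).contMDiffAt
      (e.open_target.mem_nhds hw)).mdifferentiableAt hω
  have hcont : ContinuousAt e p := e.continuousAt hp
  have hconts : ContinuousAt e.symm (e p) := e.continuousAt_symm (e.map_source hp)
  have hsrc : ∀ᶠ q in 𝓝 p, q ∈ e.source := e.open_source.mem_nhds hp
  have htgt : ∀ᶠ w in 𝓝 (e p), w ∈ e.target := e.open_target.mem_nhds (e.map_source hp)
  have hsym : Tendsto e.symm (𝓝 (e p)) (𝓝 p) := by
    have := hconts.tendsto; rwa [e.left_inv hp] at this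
  have hz : ∀ᶠ q in 𝓝 p, MDifferentiableAt 𝓘(ℂ) 𝓘(ℂ) (fun y => e y - e p) q := by
    filter_upwards [hsrc] with q hq
    exact (hde q hq).sub mdifferentiableAt_const
  refine ⟨⟨_, (fun y => e y - e p), hz, rfl⟩, ?_, ?_, ?_⟩
  · change e p - e p = 0
    simp
  · intro n hn
    have h1 : ∀ᶠ q in 𝓝 p, (e q - e p) ^ n = 0 := Germ.coe_eq.1 (congrArg Subtype.val hn)
    have h2 : ∀ᶠ w in 𝓝 (e p), w = e p := by
      filter_upwards [hsym.eventually h1, htgt] with w hw hw'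
      rw [e.right_inv hw'] at hw
      exact sub_eq_zero.1 (by by_contra h0; exact pow_ne_zero n h0 hw)
    have h3 : ({e p} : Set ℂ) ∈ 𝓝 (e p) := h2
    exact not_isOpen_singleton (e p) (isOpen_singleton_iff_nhds_eq_pure _ |>.2
      (le_antisymm (le_pure_iff.2 h3) (pure_le_nhds _)))
  · rintro ⟨_, f, hf, rfl⟩ hx
    have hF : AnalyticAt ℂ (f ∘ e.symm) (e p) := by
      rw [Complex.analyticAt_iff_eventually_differentiableAt]
      filter_upwards [hsym.eventually hf, htgt] with w h1 h2
      exact mdifferentiableAt_iff_differentiableAt.1 (h1.comp w (hds w h2))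
    have hnz : ¬ ∀ᶠ w in 𝓝 (e p), (f ∘ e.symm) w = 0 := by
      intro h
      apply hx
      refine Subtype.ext (Germ.coe_eq.2 ?_)
      filter_upwards [hcont.eventually h, hsrc] with q h1 h2
      simpa [e.left_inv h2] using h1
    obtain ⟨n, g, hg, hg0, hfg⟩ := hF.exists_eventuallyEq_pow_smul_nonzero_iff.2 hnz
    have hgd : ∀ᶠ q in 𝓝 p, MDifferentiableAt 𝓘(ℂ) 𝓘(ℂ) (g ∘ e) q := by
      have := Complex.analyticAt_iff_eventually_differentiableAt.1 hg
      filter_upwards [hcont.eventually this, hsrc] with q h1 h2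
      exact h1.mdifferentiableAt.comp q (hde q h2)
    have hu : IsUnit (⟨_, g ∘ e, hgd, rfl⟩ : holGerm p) := holGerm_isUnit _ hg0
    refine ⟨n, hu.unit, Subtype.ext (Germ.coe_eq.2 ?_)⟩
    filter_upwards [hcont.eventually hfg, hsrc] with q h1 h2
    simp only [Function.comp_apply, e.left_inv h2, smul_eq_mul] at h1
    exact h1.symm

instance (p : M) : IsDomain (holGerm p) := by
  obtain ⟨t, -, h1, h2⟩ := holGerm_factorization p
  exact isDomain_of_factorization h1 h2

instance (p : M) : IsDiscreteValuationRing (holGerm p) := by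
  obtain ⟨t, h0, h1, h2⟩ := holGerm_factorization p
  refine isDVR_of_factorization (fun h => ?_) h1 h2
  exact (h.map (evalGerm p)).ne_zero h0

theorem evalGerm_eq_zero {p : M} {φ : holGerm p} (h : φ ∈ maximalIdeal (holGerm p)) :
    evalGerm p φ = 0 := by
  by_contra h'
  exact (mem_maximalIdeal _).1 h (holGerm_isUnit φ h')

/-- The completed local ring `𝒪_p` at `p`. -/
abbrev CompletedLocalRing (p : M) : Type _ :=
  AdicCompletion (maximalIdeal (holGerm p)) (holGerm p)

instance (p : M) : IsDomain (CompletedLocalRing p) := isDomain_adicCompletion _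

instance (p : M) : IsDiscreteValuationRing (CompletedLocalRing p) := isDVR_adicCompletion _

/-- The local field `K_p`, the fraction field of the completed local ring at `p`. -/
abbrev LocalField (p : M) : Type _ := FractionRing (CompletedLocalRing p)

/-- The valuation ring `𝒪_p` inside `K_p`. -/
def integers (p : M) : Subring (LocalField p) :=
  (algebraMap (CompletedLocalRing p) (LocalField p)).range

/-- The normalised discrete valuation `v_p : K_p → ℤ` (only used for nonzero elements). -/
def ord (p : M) (k : LocalField p) : ℤ :=
  -WithZero.log ((IsDiscreteValuationRing.maximalIdeal (CompletedLocalRing p)).valuation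
    (LocalField p) k)

/-- The residue map `𝒪_p → ℂ`, which extends the evaluation of germs at `p`. -/
def residueHom (p : M) : CompletedLocalRing p →+* ℂ :=
  (Ideal.Quotient.lift (maximalIdeal (holGerm p)) (evalGerm p) fun _ h => evalGerm_eq_zero h).comp
    (AdicCompletion.evalOneₐ (maximalIdeal (holGerm p))).toRingHom

/-- The value `k(p)` of `k ∈ K_p` in the residue field `ℂ`; it is defined if and only if
`k ∈ 𝒪_p`. -/
def valueAt (p : M) : LocalField p →. ℂ := fun k =>
  ⟨k ∈ integers p, fun h => residueHom p (Classical.choose h)⟩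

theorem residueHom_mem_valueAt (p : M) (f : CompletedLocalRing p) :
    residueHom p f ∈ valueAt p (algebraMap _ (LocalField p) f) := by
  have h : algebraMap _ (LocalField p) f ∈ integers p := ⟨f, rfl⟩
  refine ⟨h, congrArg (residueHom p) ?_⟩
  exact IsFractionRing.injective (CompletedLocalRing p) (LocalField p) (Classical.choose_spec h)

end LocalRing

/-! ### Adeles -/

section Adeles

variable (M : Type*) [TopologicalSpace M] [ChartedSpace ℂ M] [IsManifold 𝓘(ℂ) ω M]

/-- The adele ring of `M`: families `(a_p)` with `a_p ∈ K_p` for all `p` and `a_p ∈ 𝒪_p` for all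
but finitely many `p`. Its group of units is the idele group. -/
abbrev Adele : Type _ := Πʳ p : M, [LocalField p, integers p]

end Adeles

/-! ### Green functions -/

section Green

variable {M : Type*} [TopologicalSpace M] [ChartedSpace ℂ M]

/-- Near `x` the partial function `g` equals `a log |z|² + u`, where `z` is a holomorphic chart
centred at `x` and `u` is smooth. The equality is one of partial functions: the right-hand side
is defined away from `x`, and also at `x` in case `a = 0`. -/
def HasLogForm (g : M →. ℝ) (x : M) (a : ℝ) : Prop :=
  ∃ (z : OpenPartialHomeomorph M ℂ) (V : Set M) (u : M → ℝ),
    z ∈ IsManifold.maximalAtlas 𝓘(ℂ) ω M ∧ z x = 0 ∧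
    IsOpen V ∧ x ∈ V ∧ V ⊆ z.source ∧
    ContMDiffOn 𝓘(ℝ, ℂ) 𝓘(ℝ, ℝ) ∞ u V ∧
    ∀ y ∈ V, (y ∈ g.Dom ↔ y ≠ x ∨ a = 0) ∧
      ∀ r ∈ g y, r = a * Real.log (‖z y‖ ^ 2) + u y

/-- Green functions on `M`, as partially defined real functions. -/
structure IsGreen (g : M →. ℝ) : Prop where
  finite_compl_dom : g.Domᶜ.Finite
  smooth : ∃ f : M → ℝ, ContMDiffOn 𝓘(ℝ, ℂ) 𝓘(ℝ, ℝ) ∞ f g.Dom ∧ ∀ x ∈ g.Dom, f x ∈ g x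
  hasLogForm : ∀ x, ∃ a : ℝ, HasLogForm g x a

open Classical in
/-- The Green order of `g` at `x`, that is, `-a` for the coefficient `a` of `HasLogForm`. -/
def greenOrder (g : M →. ℝ) (x : M) : ℝ :=
  if h : ∃ a : ℝ, HasLogForm g x a then -Classical.choose h else 0

theorem HasLogForm.unique {g : M →. ℝ} {x : M} {a b : ℝ} (ha : HasLogForm g x a)
    (hb : HasLogForm g x b) : a = b := by
  obtain ⟨z, V, u, hz, hzx, hV, hxV, hVz, hu, hg⟩ := ha
  obtain ⟨z', V', u', hz', hzx', hV', hxV', hVz', hu', hg'⟩ := hb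
  have hω : (ω : WithTop ℕ∞) ≠ 0 := by simp
  have hx := hVz hxV
  have hx' := hVz' hxV'
  -- every transition map between two centred charts is differentiable at the origin
  have key : ∀ c ∈ IsManifold.maximalAtlas 𝓘(ℂ) ω M, ∀ d ∈ IsManifold.maximalAtlas 𝓘(ℂ) ω M,
      x ∈ c.source → x ∈ d.source → c x = 0 → DifferentiableAt ℂ (d ∘ c.symm) 0 := by
    intro c hc d hd hxc hxd hcx
    have h0 : (0 : ℂ) ∈ c.target := hcx ▸ c.map_source hxc
    have hsx : c.symm 0 = x := by rw [← hcx, c.left_inv hxc]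
    have h1 : MDifferentiableAt 𝓘(ℂ) 𝓘(ℂ) c.symm 0 :=
      ((contMDiffOn_symm_of_mem_maximalAtlas hc).contMDiffAt
        (c.open_target.mem_nhds h0)).mdifferentiableAt hω
    have h2 : MDifferentiableAt 𝓘(ℂ) 𝓘(ℂ) d (c.symm 0) := by
      rw [hsx]
      exact ((contMDiffOn_of_mem_maximalAtlas hd).contMDiffAt
        (d.open_source.mem_nhds hxd)).mdifferentiableAt hω
    exact mdifferentiableAt_iff_differentiableAt.1 (h2.comp _ h1)
  have h0 : (0 : ℂ) ∈ z.target := hzx ▸ z.map_source hx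
  have hsx : z.symm 0 = x := by rw [← hzx, z.left_inv hx]
  have hsc : Tendsto z.symm (𝓝 0) (𝓝 x) := by
    have := (z.continuousAt_symm h0).tendsto; rwa [hsx] at this
  set T : ℂ → ℂ := z' ∘ z.symm with hT
  set S : ℂ → ℂ := z ∘ z'.symm with hS
  have hTd : DifferentiableAt ℂ T 0 := key z hz z' hz' hx hx' hzx
  have hSd : DifferentiableAt ℂ S 0 := key z' hz' z hz hx' hx hzx'
  have hT0 : T 0 = 0 := by simp [hT, hsx, hzx']
  have hST : S ∘ T =ᶠ[𝓝 0] id := by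
    filter_upwards [hsc.eventually (z'.open_source.mem_nhds hx'), z.open_target.mem_nhds h0]
      with w h1 h2
    have h1' : z'.symm (z' (z.symm w)) = z.symm w := z'.left_inv h1
    simp [hS, hT, h1', z.right_inv h2]
  have hT' : deriv T 0 ≠ 0 := by
    intro h
    have h1 : HasDerivAt (S ∘ T) (deriv S (T 0) * deriv T 0) 0 :=
      HasDerivAt.comp 0 (by rw [hT0]; exact hSd.hasDerivAt) hTd.hasDerivAt
    have h2 : HasDerivAt (S ∘ T) 1 0 := (hasDerivAt_id (0 : ℂ)).congr_of_eventuallyEq hST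
    have := h1.unique h2
    simp [h] at this
  have hslope : Tendsto (fun w => Real.log (‖w⁻¹ * T w‖ ^ 2)) (𝓝[≠] (0 : ℂ))
      (𝓝 (Real.log (‖deriv T 0‖ ^ 2))) := by
    have h1 := hasDerivAt_iff_tendsto_slope.1 hTd.hasDerivAt
    have h2 : slope T 0 = fun w => w⁻¹ * T w := by
      funext w; simp [slope, hT0]
    rw [h2] at h1
    exact ((h1.norm.pow 2).log (by simpa using hT'))
  have hcu : ∀ (v : M → ℝ) (W : Set M), IsOpen W → x ∈ W →
      ContMDiffOn 𝓘(ℝ, ℂ) 𝓘(ℝ, ℝ) ∞ v W →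
      Tendsto (fun w => v (z.symm w)) (𝓝[≠] (0 : ℂ)) (𝓝 (v x)) := by
    intro v W hW hxW hv
    exact ((hv.continuousOn.continuousAt (hW.mem_nhds hxW)).tendsto.comp hsc).mono_left
      nhdsWithin_le_nhds
  have heq : ∀ᶠ w in 𝓝[≠] (0 : ℂ), (a - b) * Real.log (‖w‖ ^ 2) =
      b * Real.log (‖w⁻¹ * T w‖ ^ 2) + u' (z.symm w) - u (z.symm w) := by
    have h1 : ∀ᶠ w in 𝓝[≠] (0 : ℂ), z.symm w ∈ V ∩ V' ∧ w ∈ z.target :=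
      nhdsWithin_le_nhds ((hsc.eventually ((hV.inter hV').mem_nhds ⟨hxV, hxV'⟩)).and
        (z.open_target.mem_nhds h0))
    filter_upwards [h1, self_mem_nhdsWithin] with w hw hw0
    have hw0 : w ≠ 0 := hw0
    have hne : z.symm w ≠ x := by
      intro h
      apply hw0
      rw [← z.right_inv hw.2, h, hzx]
    have hTw : T w ≠ 0 := by
      intro h
      apply hne
      have h3 : z' (z.symm w) = z' x := by rw [hzx']; exact h
      exact z'.injOn (hVz' hw.1.2) hx' h3
    obtain ⟨hd, hr⟩ := hg _ hw.1.1
    obtain ⟨-, hr'⟩ := hg' _ hw.1.2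
    obtain ⟨r, hrm⟩ := Part.dom_iff_mem.1 (hd.2 (Or.inl hne))
    have e1 := hr r hrm
    have e2 := hr' r hrm
    rw [z.right_inv hw.2] at e1
    have e3 : Real.log (‖w⁻¹ * T w‖ ^ 2) = Real.log (‖T w‖ ^ 2) - Real.log (‖w‖ ^ 2) := by
      have : ‖w⁻¹ * T w‖ ^ 2 = ‖T w‖ ^ 2 / ‖w‖ ^ 2 := by
        rw [norm_mul, norm_inv]; field_simp
      rw [this, Real.log_div (by simpa using hTw) (by simpa using hw0)]
    have e4 : r = b * Real.log (‖T w‖ ^ 2) + u' (z.symm w) := e2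
    rw [e3]
    linarith
  have hlim := (((hslope.const_mul b).add (hcu u' V' hV' hxV' hu')).sub
    (hcu u V hV hxV hu)).congr' (heq.mono fun w hw => hw.symm)
  by_contra hab
  have hbot : Tendsto (fun w : ℂ => Real.log (‖w‖ ^ 2)) (𝓝[≠] 0) atBot := by
    refine Real.tendsto_log_nhdsNE_zero.comp ?_
    refine tendsto_nhdsWithin_iff.2 ⟨?_, ?_⟩
    · have : Tendsto (fun w : ℂ => ‖w‖ ^ 2) (𝓝 0) (𝓝 (‖(0 : ℂ)‖ ^ 2)) :=
        (continuous_norm.pow 2).tendsto 0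
      simpa using this.mono_left nhdsWithin_le_nhds
    · filter_upwards [self_mem_nhdsWithin] with w hw
      have hw : w ≠ 0 := hw
      simpa using hw
  have hlim2 : Tendsto (fun w : ℂ => Real.log (‖w‖ ^ 2)) (𝓝[≠] 0) (𝓝 _) :=
    (hlim.const_mul (a - b)⁻¹).congr fun w => by
      rw [inv_mul_cancel_left₀ (sub_ne_zero.2 hab)]
  exact not_tendsto_nhds_of_tendsto_atBot hbot _ hlim2

theorem HasLogForm.greenOrder_eq {g : M →. ℝ} {x : M} {a : ℝ} (h : HasLogForm g x a) :
    greenOrder g x = -a := by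
  have h' : ∃ a : ℝ, HasLogForm g x a := ⟨a, h⟩
  rw [greenOrder, dif_pos h', (Classical.choose_spec h').unique h]

end Green

/-! ### The map from pairs of ideles to Green functions -/

section Pi

variable (M : Type*) [TopologicalSpace M] [ChartedSpace ℂ M]

/-- Green functions with integer orders. -/
def ZGreen : Set (M →. ℝ) :=
  {g | IsGreen g ∧ ∀ x, ∃ n : ℤ, greenOrder g x = n}

variable [IsManifold 𝓘(ℂ) ω M]

/-- The partial function `x ↦ b(x) a(x) \overline{a(x)}`, defined where `a(x)` and `b(x)` are. -/
def hermitianValue (a b : (Adele M)ˣ) : M →. ℂ := fun x =>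
  (valueAt x ((b : Adele M) x)).bind fun β =>
    (valueAt x ((a : Adele M) x)).map fun α => β * α * conj α

/-- The partial real function `-log(b a ā)`; it is defined at those `x` where `a(x)` and `b(x)`
are defined and `b(x) a(x) \overline{a(x)}` is a positive real number. -/
def theta (a b : (Adele M)ˣ) : M →. ℝ := fun x =>
  (hermitianValue M a b x).bind fun c => ⟨0 < c, fun _ => -Real.log c.re⟩

/-- The pairs `(a, b)` of ideles for which `-log(b a ā)` is a Green function with integer orders
and `v_x(a_x)` is its Green order at every `x`. -/
def ideleGreen : Set ((Adele M)ˣ × (Adele M)ˣ) :=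
  {p | theta M p.1 p.2 ∈ ZGreen M ∧
    ∀ x, (ord x ((p.1 : Adele M) x) : ℝ) = greenOrder (theta M p.1 p.2) x}

/-- The map `(a, b) ↦ -log(b a ā)` from these pairs to Green functions with integer orders. -/
def piMap (p : ideleGreen M) : ZGreen M :=
  ⟨theta M p.1.1 p.1.2, p.2.1⟩

end Pi

end RiemannSurface

end

namespace RiemannSurface

section

variable {M : Type*} [TopologicalSpace M] [ChartedSpace ℂ M]

/-! The adelic condition relates the components at different points only through integrality at
almost all of them, so the two ideles can be chosen point by point, with no analytic compatibility.
Let `n x` be the Green order of `g` at `x`, and let `f` be a total function agreeing with `g` on its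
domain. Take `a` with component the `n x`-th power of a uniformizer, and `b` with component the
nonzero constant `exp (-f x)`.

By the partial equality in the local form, `g` is defined at `x` exactly when `n x = 0`
(`IsGreen.mem_dom_iff`). There `a` is `1`, and `-log (b a ā)` is `f x`. If `n x > 0`, the value of
`a` is `0` and positivity fails; if `n x < 0`, `a` has no value at all
(`value_uniformizerZPow_eq_zero`). So `-log (b a ā)` and `g` agree as partial functions, domains
included. The order condition is the valuation of a power of a uniformizer (`ord_uniformizerZPow`).
-/

/-- The germ at `p` of a constant function. -/
def constGerm (p : M) (c : ℂ) : holGerm p :=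
  ⟨_, fun _ => c, Eventually.of_forall fun _ => mdifferentiableAt_const, rfl⟩

theorem HasLogForm.mem_dom_iff {g : M →. ℝ} {x : M} {a : ℝ} (h : HasLogForm g x a) :
    x ∈ g.Dom ↔ a = 0 := by
  obtain ⟨z, V, u, -, -, -, hxV, -, -, hg⟩ := h
  simpa using (hg x hxV).1

theorem IsGreen.mem_dom_iff {g : M →. ℝ} (hg : IsGreen g) (x : M) :
    x ∈ g.Dom ↔ greenOrder g x = 0 := by
  obtain ⟨a, ha⟩ := hg.hasLogForm x
  rw [ha.mem_dom_iff, ha.greenOrder_eq, neg_eq_zero]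

variable [IsManifold 𝓘(ℂ) ω M]

/-! ### Residues and constants in the completed local ring -/

theorem residueHom_algebraMap (p : M) (φ : holGerm p) :
    residueHom p (algebraMap (holGerm p) (CompletedLocalRing p) φ) = evalGerm p φ := by
  simp only [residueHom, RingHom.comp_apply]
  have : (AdicCompletion.evalOneₐ (maximalIdeal (holGerm p))).toRingHom
      (algebraMap (holGerm p) (CompletedLocalRing p) φ) =
      Ideal.Quotient.mk (maximalIdeal (holGerm p)) φ :=
    (AdicCompletion.evalOneₐ (maximalIdeal (holGerm p))).commutes φ
  rw [this, Ideal.Quotient.lift_mk]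

/-- The constants make the residue map surjective onto the field `ℂ`, so its kernel is a maximal
ideal, and a local ring has only one. -/
theorem residueHom_eq_zero {p : M} {f : CompletedLocalRing p} (hf : ¬ IsUnit f) :
    residueHom p f = 0 := by
  have hsurj : Function.Surjective (residueHom p) := fun c =>
    ⟨_, residueHom_algebraMap p (constGerm p c)⟩
  have hker := RingHom.ker_isMaximal_of_surjective (residueHom p) hsurj
  have hmem : f ∈ maximalIdeal (CompletedLocalRing p) := (mem_maximalIdeal _).2 hf
  rw [← IsLocalRing.eq_maximalIdeal hker] at hmem
  exact hmem

/-- The constant `c` as an element of the local field at `p`. -/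
noncomputable def constLocal (p : M) (c : ℂ) : LocalField p :=
  algebraMap (CompletedLocalRing p) (LocalField p)
    (algebraMap (holGerm p) (CompletedLocalRing p) (constGerm p c))

theorem mem_valueAt_constLocal (p : M) (c : ℂ) : c ∈ valueAt p (constLocal p c) := by
  have := residueHom_mem_valueAt p (algebraMap (holGerm p) (CompletedLocalRing p) (constGerm p c))
  rwa [residueHom_algebraMap] at this

theorem constLocal_mem_integers (p : M) (c : ℂ) : constLocal p c ∈ integers p := ⟨_, rfl⟩

theorem constLocal_mul_constLocal_inv (p : M) {c : ℂ} (hc : c ≠ 0) :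
    constLocal p c * constLocal p c⁻¹ = 1 := by
  have : constGerm p c * constGerm p c⁻¹ = 1 :=
    Subtype.ext (Germ.coe_eq.2 (Eventually.of_forall fun _ => mul_inv_cancel₀ hc))
  rw [constLocal, constLocal, ← map_mul, ← map_mul, this, map_one, map_one]

/-! ### Powers of a uniformizer: valuation and residue -/

/-- A uniformizer of the completed local ring at `p`. -/
noncomputable def uniformizer (p : M) : CompletedLocalRing p :=
  Classical.choose (IsDiscreteValuationRing.exists_irreducible (CompletedLocalRing p))

theorem irreducible_uniformizer (p : M) : Irreducible (uniformizer p) :=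
  Classical.choose_spec (IsDiscreteValuationRing.exists_irreducible (CompletedLocalRing p))

/-- The `n`-th power of a uniformizer in the local field at `p`. -/
noncomputable def uniformizerZPow (p : M) (n : ℤ) : LocalField p :=
  algebraMap (CompletedLocalRing p) (LocalField p) (uniformizer p) ^ n

theorem algebraMap_uniformizer_ne_zero (p : M) :
    algebraMap (CompletedLocalRing p) (LocalField p) (uniformizer p) ≠ 0 := by
  simpa using (irreducible_uniformizer p).ne_zero

theorem uniformizerZPow_mul_neg (p : M) (n : ℤ) :
    uniformizerZPow p n * uniformizerZPow p (-n) = 1 := by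
  rw [uniformizerZPow, uniformizerZPow, ← zpow_add₀ (algebraMap_uniformizer_ne_zero p)]
  simp

theorem uniformizerZPow_zero (p : M) : uniformizerZPow p 0 = 1 := zpow_zero _

theorem uniformizerZPow_natCast (p : M) (n : ℕ) : uniformizerZPow p n =
    algebraMap (CompletedLocalRing p) (LocalField p) (uniformizer p ^ n) := by
  rw [uniformizerZPow, zpow_natCast, map_pow]

theorem ord_uniformizerZPow (p : M) (n : ℤ) : ord p (uniformizerZPow p n) = n := by
  have h : (IsDiscreteValuationRing.maximalIdeal (CompletedLocalRing p)).valuation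
      (LocalField p) (algebraMap (CompletedLocalRing p) (LocalField p) (uniformizer p)) =
      WithZero.exp (-1 : ℤ) := by
    rw [IsDedekindDomain.HeightOneSpectrum.valuation_of_algebraMap]
    exact IsDedekindDomain.HeightOneSpectrum.intValuation_singleton _
      (irreducible_uniformizer p).ne_zero (irreducible_uniformizer p).maximalIdeal_eq
  rw [ord, uniformizerZPow, map_zpow₀, h, WithZero.log_zpow, WithZero.log_exp]
  simp

/-- For positive `n` the power is a nonunit of the completed local ring, so its residue vanishes.
For negative `n` it is not integral, and the claim is vacuous. -/
theorem value_uniformizerZPow_eq_zero {p : M} {n : ℤ} (hn : n ≠ 0) {c : ℂ}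
    (hc : c ∈ valueAt p (uniformizerZPow p n)) : c = 0 := by
  obtain ⟨m, rfl | rfl⟩ := n.eq_nat_or_neg
  · rw [uniformizerZPow_natCast] at hc
    refine (Part.mem_unique hc (residueHom_mem_valueAt p _)).trans (residueHom_eq_zero ?_)
    rw [isUnit_pow_iff (by simpa using hn)]
    exact (irreducible_uniformizer p).not_isUnit
  -- If the power with exponent `-m` came from some `f` in the ring, then `f` would be an inverse of
  -- the `m`-th power of the uniformizer.
  · obtain ⟨⟨f, hf⟩, -⟩ := hc
    have h := uniformizerZPow_mul_neg p m
    rw [← hf, uniformizerZPow_natCast, ← map_mul,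
      ← map_one (algebraMap (CompletedLocalRing p) (LocalField p))] at h
    have h1 := IsFractionRing.injective (CompletedLocalRing p) (LocalField p) h
    have h2 := IsUnit.of_mul_eq_one _ h1
    rw [isUnit_pow_iff (by simpa using hn)] at h2
    exact absurd h2 (irreducible_uniformizer p).not_isUnit

theorem one_mem_valueAt_one (p : M) : (1 : ℂ) ∈ valueAt p (1 : LocalField p) := by
  have := residueHom_mem_valueAt p 1
  rwa [map_one, map_one] at this

/-! ### Ideles with prescribed components and the values of `theta` -/

/-- The idele with components `u p` and inverse components `v p`. -/
noncomputable def ideleOf (u v : ∀ p : M, LocalField p) (huv : ∀ p, u p * v p = 1)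
    (hu : ∀ᶠ p in cofinite, u p ∈ integers p) (hv : ∀ᶠ p in cofinite, v p ∈ integers p) :
    (Adele M)ˣ where
  val := ⟨u, hu⟩
  inv := ⟨v, hv⟩
  val_inv := RestrictedProduct.ext _ _ huv
  inv_val := RestrictedProduct.ext _ _ fun p => (mul_comm _ _).trans (huv p)

theorem ideleOf_apply (u v : ∀ p : M, LocalField p) (huv : ∀ p, u p * v p = 1)
    (hu : ∀ᶠ p in cofinite, u p ∈ integers p) (hv : ∀ᶠ p in cofinite, v p ∈ integers p) (p : M) :
    (ideleOf u v huv hu hv : Adele M) p = u p := rfl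

theorem mem_theta {a b : (Adele M)ˣ} {x : M} {r : ℝ} : r ∈ theta M a b x ↔
    ∃ β ∈ valueAt x ((b : Adele M) x), ∃ α ∈ valueAt x ((a : Adele M) x),
      0 < β * α * conj α ∧ -Real.log (β * α * conj α).re = r := by
  simp only [theta, hermitianValue, Part.mem_bind_iff, Part.mem_map_iff, Part.mem_mk_iff]
  constructor
  · rintro ⟨c, ⟨β, hβ, α, hα, rfl⟩, h, hr⟩
    exact ⟨β, hβ, α, hα, h, hr⟩
  · rintro ⟨β, hβ, α, hα, h, hr⟩
    exact ⟨_, ⟨β, hβ, α, hα, rfl⟩, h, hr⟩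

/-- The order condition refers to `g` rather than to `theta M a b`; once the two are identified, it
is the second condition in `ideleGreen`. -/
theorem exists_ideles_theta_eq {g : M →. ℝ} (hg : g ∈ ZGreen M) :
    ∃ a b : (Adele M)ˣ, theta M a b = g ∧
      ∀ x, (ord x ((a : Adele M) x) : ℝ) = greenOrder g x := by
  obtain ⟨hG, hint⟩ := hg
  choose n hn using hint
  obtain ⟨f, -, hf⟩ := hG.smooth
  have hdom : ∀ x, x ∈ g.Dom ↔ n x = 0 := fun x => by
    rw [hG.mem_dom_iff, hn, Int.cast_eq_zero]
  -- Since `n` vanishes on the domain of `g`, whose complement is finite, almost every component of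
  -- `a` and of its inverse is `1`.
  have hfin : ∀ᶠ x in cofinite, n x = 0 :=
    hG.finite_compl_dom.subset fun x hx h => hx ((hdom x).1 h)
  have hexp : ∀ x, (Real.exp (-f x) : ℂ) ≠ 0 := fun x =>
    Complex.ofReal_ne_zero.2 (Real.exp_ne_zero _)
  let a : (Adele M)ˣ := ideleOf (fun x => uniformizerZPow x (n x))
    (fun x => uniformizerZPow x (-n x)) (fun x => uniformizerZPow_mul_neg x _)
    (hfin.mono fun x hx => by rw [hx, uniformizerZPow_zero]; exact one_mem _)
    (hfin.mono fun x hx => by rw [hx, neg_zero, uniformizerZPow_zero]; exact one_mem _)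
  -- Off the domain of `g` the value of `f` is arbitrary. This is harmless: the exponential is
  -- nonzero, so the component is still an integral unit, and there `a` alone makes `theta`
  -- undefined.
  let b : (Adele M)ˣ := ideleOf (fun x => constLocal x (Real.exp (-f x) : ℂ))
    (fun x => constLocal x (Real.exp (-f x) : ℂ)⁻¹)
    (fun x => constLocal_mul_constLocal_inv x (hexp x))
    (Eventually.of_forall fun x => constLocal_mem_integers x _)
    (Eventually.of_forall fun x => constLocal_mem_integers x _)
  refine ⟨a, b, funext fun x => Part.ext fun r => ?_, fun x => ?_⟩
  · rw [mem_theta, ideleOf_apply, ideleOf_apply]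
    by_cases hx : n x = 0
    · have hgx : r ∈ g x ↔ f x = r :=
        ⟨fun h => Part.mem_unique (hf x ((hdom x).2 hx)) h,
          fun h => h ▸ hf x ((hdom x).2 hx)⟩
      rw [hgx, hx, uniformizerZPow_zero]
      constructor
      · rintro ⟨β, hβ, α, hα, -, rfl⟩
        rw [Part.mem_unique hβ (mem_valueAt_constLocal x _),
          Part.mem_unique hα (one_mem_valueAt_one x), map_one, mul_one, mul_one,
          Complex.ofReal_re, Real.log_exp, neg_neg]
      · rintro rfl
        refine ⟨_, mem_valueAt_constLocal x _, 1, one_mem_valueAt_one x, ?_, ?_⟩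
        · rw [map_one, mul_one, mul_one]
          exact Complex.zero_lt_real.2 (Real.exp_pos _)
        · rw [map_one, mul_one, mul_one, Complex.ofReal_re, Real.log_exp, neg_neg]
    -- Here `n x ≠ 0` and both sides are empty: a value of `a` could only be `0`, against positivity
    -- of the product, and `g` is undefined at `x`.
    · constructor
      · rintro ⟨β, -, α, hα, hpos, -⟩
        rw [value_uniformizerZPow_eq_zero hx hα] at hpos
        simp at hpos
      · exact fun h => absurd ((hdom x).1 (Part.dom_iff_mem.2 ⟨r, h⟩)) hx
  · rw [ideleOf_apply, ord_uniformizerZPow, hn]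

end

end RiemannSurface

theorem mainTheorem10 (X : Type*) [TopologicalSpace X] [T2Space X] [CompactSpace X]
    [ConnectedSpace X] [ChartedSpace ℂ X] [IsManifold 𝓘(ℂ) ω X] :
    Function.Surjective (RiemannSurface.piMap X) := by
  rintro ⟨g, hg⟩
  obtain ⟨a, b, hab, hord⟩ := RiemannSurface.exists_ideles_theta_eq hg
  -- Replacing `g` by `theta M a b` turns `hg` and `hord` into the two membership conditions of
  -- `ideleGreen`.
  subst hab
  exact ⟨⟨(a, b), hg, hord⟩, rfl⟩
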